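/- Let $h\colon[n]\to[n]$ be a Hessenberg function ($h(1)\le\dots\le h(n)$ and $h(j)\ge j$ for all $j$), let $S$ be a complex $n\times n$ matrix with $n$ distinct eigenvalues, and let $$\mathrm{Hess}(S,h)=\{(V_1\subset\cdots\subset V_n=\mathbb C^n)\in \mathrm{Fl}(\mathbb C^n)\mid SV_j\subset V_{h(j)}\ \text{for all } j\in[n]\}$$ be the corresponding regular semisimple Hessenberg variety, where $\mathrm{Fl}(\mathbb C^n)=\mathrm{GL}_n(\mathbb C)/B$ is the variety of complete flags ($\dim V_i=i$). Let $L=\{\sum_i a_it_i\mid a_i\in\mathbb Z,\ \sum_i a_i=0\}$, which is identified with $H^2(BT)$ for the compact torus $T=(S^1)^n/S^1$, and identify $H^*(BT)$ with the symmetric algebra $\mathrm{Sym}_{\mathbb Z}(L)$. The GKM graph $(\Gamma_h,\alpha_h)$ of $\mathrm{Hess}(S,h)$ has vertex set $\mathfrak S_n$, an oriented edge $(w,w(i,j))$ for each $w\in\mathfrak S_n$ and $j<i\le h(j)$, where $(i,j)$ is a transposition, and labels $\alpha_h(w,w(i,j))=t_{w(i)}-t_{w(j)}\in L$. For a GKM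 graph $(\Gamma,\alpha)$ with labels in $H^2(BT)$, an automorphism is a pair $(\varphi,\phi)$ of a graph automorphism $\varphi$ of $\Gamma$ and a group automorphism $\phi$ of $H^2(BT)$ with $\phi(\alpha(e))=\alpha(\varphi(e))$ for all oriented edges $e$; these form a group $\mathrm{Aut}(\Gamma,\alpha)$. The equivariant graph cohomology $H^*_T(\Gamma,\alpha)$ is the ring of maps $\xi\colon V(\Gamma)\to H^*(BT)$ such that $\xi(p)\equiv\xi(q)$ modulo $\alpha(e)$ for every edge $e$ from $p$ to $q$, and the graph cohomology $H^*(\Gamma,\alpha)$ is its quotient by the ideal generated by the constant maps with value in $H^{>0}(BT)$. An automorphism acts by $((\varphi,\phi)^*\xi)(p)=\phi^{-1}(\xi(\varphi(p)))$, and this descends to $H^*(\Gamma,\alpha)$. Let $\mathrm{Aut}^*(\Gamma,\alpha)$ be the subgroup of the elements of $\mathrm{Aut}(\Gamma,\alpha)$ that act trivially on $H^*(\Gamma,\alpha)\otimes\mathbb Q$. For $\sigma\in\mathfrak S_n$ let $\Phi_\sigma\in\mathrm{Aut}(\Gamma_h,\alpha_h)$ be given by $w\mapsto\sigma w$ on vertices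 and $t_i\mapsto t_{\sigma(i)}$ on labels. Suppose that $\mathrm{Hess}(S,h)$ is connected. If $\mathrm{Hess}(S,h)=\mathrm{Fl}(\mathbb C^n)$, then $\mathrm{Aut}^*(\Gamma_h,\alpha_h)=\{\Phi_\sigma\mid\sigma\in\mathfrak S_n\}$. Otherwise $\mathrm{Aut}^*(\Gamma_h,\alpha_h)$ is trivial. -/

import Mathlib

open scoped TensorProduct

noncomputable section

/-! ### GKM graphs

A compact torus `T` enters through the free abelian group `L = H²(BT) = Hom(T, S¹)` of finite rank;
the ring `H^*(BT)` is the symmetric algebra of `L` over `ℤ`. -/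

/-- A GKM graph with vertex set `V`, set of oriented edges `E` and labels in `L`. -/
structure GKMGraph (V E L : Type) [Finite V] [Finite E] [AddCommGroup L]
    [Module.Free ℤ L] [Module.Finite ℤ L] where
  /-- initial vertex -/
  init : E → V
  /-- terminal vertex -/
  term : E → V
  /-- orientation reversal -/
  bar : E → E
  bar_bar : ∀ e, bar (bar e) = e
  bar_ne : ∀ e, bar e ≠ e
  init_bar : ∀ e, init (bar e) = term e
  regular : ∃ d : ℕ, ∀ p, Nat.card {e : E // init e = p} = d
  /-- axial function -/
  label : E → L
  label_bar : ∀ e, label (bar e) = -label e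
  label_indep : ∀ e e', init e = init e' → e ≠ e' → LinearIndependent ℤ ![label e, label e']
  /-- the labels at the two ends of an edge `e` agree modulo `label e`, up to a bijection -/
  label_congr : ∀ e, ∃ b : {e' : E // init e' = init e} ≃ {e' : E // init e' = term e},
    ∀ e', ∃ c : ℤ, label (b e') - label e' = c • label e

/-- The algebra map `Sym(L) → Sym(L)` induced by an endomorphism of `L`. -/
def symMap {L : Type} [AddCommGroup L] (f : L →ₗ[ℤ] L) :
    SymmetricAlgebra ℤ L →ₐ[ℤ] SymmetricAlgebra ℤ L :=
  SymmetricAlgebra.lift (SymmetricAlgebra.ι ℤ L ∘ₗ f)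

theorem symMap_ι {L : Type} [AddCommGroup L] (f : L →ₗ[ℤ] L) (x : L) :
    symMap f (SymmetricAlgebra.ι ℤ L x) = SymmetricAlgebra.ι ℤ L (f x) := by
  simp [symMap]

theorem symMap_one {L : Type} [AddCommGroup L] (x : SymmetricAlgebra ℤ L) :
    symMap (LinearMap.id : L →ₗ[ℤ] L) x = x := by
  have : symMap (LinearMap.id : L →ₗ[ℤ] L) = AlgHom.id ℤ _ := by
    apply SymmetricAlgebra.algHom_ext
    ext y
    simp [symMap_ι]
  rw [this]; rfl

theorem symMap_comp {L : Type} [AddCommGroup L] (f g : L →ₗ[ℤ] L) (x : SymmetricAlgebra ℤ L) :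
    symMap (f ∘ₗ g) x = symMap f (symMap g x) := by
  have : symMap (f ∘ₗ g) = (symMap f).comp (symMap g) := by
    apply SymmetricAlgebra.algHom_ext
    ext y
    simp [symMap_ι]
  rw [this]; rfl

theorem algebraMapInv_symMap {L : Type} [AddCommGroup L] (f : L →ₗ[ℤ] L)
    (x : SymmetricAlgebra ℤ L) :
    SymmetricAlgebra.algebraMapInv (symMap f x) = SymmetricAlgebra.algebraMapInv x := by
  have : (SymmetricAlgebra.algebraMapInv (R := ℤ) (M := L)).comp (symMap f) =
      SymmetricAlgebra.algebraMapInv := by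
    apply SymmetricAlgebra.algHom_ext
    ext y
    simp [symMap_ι, SymmetricAlgebra.algebraMapInv_ι]
  exact DFunLike.congr_fun this x

namespace GKMGraph

variable {V E L : Type} [Finite V] [Finite E] [AddCommGroup L]
  [Module.Free ℤ L] [Module.Finite ℤ L] (G : GKMGraph V E L)

/-- The automorphism group of a GKM graph: a graph automorphism (a permutation of the vertices and
a permutation of the oriented edges, compatible with ends and orientation reversal) together with an
automorphism of the abelian group `L` matching the labels. -/
def Aut : Subgroup (Equiv.Perm V × Equiv.Perm E × (L ≃ₗ[ℤ] L)) where
  carrier := {F | (∀ e, G.init (F.2.1 e) = F.1 (G.init e)) ∧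
    (∀ e, G.term (F.2.1 e) = F.1 (G.term e)) ∧
    (∀ e, G.bar (F.2.1 e) = F.2.1 (G.bar e)) ∧
    ∀ e, F.2.2 (G.label e) = G.label (F.2.1 e)}
  one_mem' := by simp
  mul_mem' := by
    rintro ⟨a, b, c⟩ ⟨a', b', c'⟩ ⟨h1, h2, h3, h4⟩ ⟨h1', h2', h3', h4'⟩
    simp_all
  inv_mem' := by
    rintro ⟨a, b, c⟩ ⟨h1, h2, h3, h4⟩
    dsimp only [Prod.fst_inv, Prod.snd_inv, Set.mem_ofPred_eq] at *
    refine ⟨fun e => ?_, fun e => ?_, fun e => ?_, fun e => ?_⟩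
    · apply a.injective; rw [← h1]; simp
    · apply a.injective; rw [← h2]; simp
    · apply b.injective; rw [← h3]; simp
    · apply c.injective; rw [h4]
      simp [LinearEquiv.coe_inv]

/-- Equivariant graph cohomology. -/
def eqCohomology : Subring (V → SymmetricAlgebra ℤ L) where
  carrier := {ξ | ∀ e, SymmetricAlgebra.ι ℤ L (G.label e) ∣ ξ (G.init e) - ξ (G.term e)}
  mul_mem' := by
    intro ξ η hξ hη e
    have : (ξ * η) (G.init e) - (ξ * η) (G.term e) =
        (ξ (G.init e) - ξ (G.term e)) * η (G.init e) +
          ξ (G.term e) * (η (G.init e) - η (G.term e)) := by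
      simp only [Pi.mul_apply]; ring
    rw [this]
    exact dvd_add ((hξ e).mul_right _) ((hη e).mul_left _)
  add_mem' := by
    intro ξ η hξ hη e
    have : (ξ + η) (G.init e) - (ξ + η) (G.term e) =
        (ξ (G.init e) - ξ (G.term e)) + (η (G.init e) - η (G.term e)) := by
      simp only [Pi.add_apply]; ring
    rw [this]
    exact dvd_add (hξ e) (hη e)
  zero_mem' := by
    intro e
    simp
  one_mem' := by
    intro e
    simp
  neg_mem' := by
    intro ξ hξ e
    have : (-ξ) (G.init e) - (-ξ) (G.term e) = -(ξ (G.init e) - ξ (G.term e)) := by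
      simp only [Pi.neg_apply]; ring
    rw [this]
    exact (hξ e).neg_right

/-- An element of `H^*(BT)`, as a constant function in the equivariant graph cohomology. -/
def const (f : SymmetricAlgebra ℤ L) : G.eqCohomology :=
  ⟨fun _ => f, fun e => by simp⟩

/-- The ideal generated by the elements of `H^*(BT)` with vanishing degree zero term. -/
def posIdeal : Ideal G.eqCohomology :=
  Ideal.span {ξ | ∃ f : SymmetricAlgebra ℤ L, SymmetricAlgebra.algebraMapInv f = 0 ∧ ξ = G.const f}

/-- (Ordinary) graph cohomology. -/
def Cohomology : Type := G.eqCohomology ⧸ G.posIdeal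

instance : CommRing G.Cohomology := inferInstanceAs (CommRing (G.eqCohomology ⧸ G.posIdeal))

/-- The quotient map from equivariant to ordinary graph cohomology. -/
def toCohomology : G.eqCohomology →+* G.Cohomology := Ideal.Quotient.mk G.posIdeal

theorem toCohomology_surjective : Function.Surjective G.toCohomology :=
  Ideal.Quotient.mk_surjective

variable {G}

/-- The action `ξ ↦ (p ↦ ϕ⁻¹ (ξ (φ p)))` of an automorphism on equivariant graph cohomology. -/
def eqPullback (F : G.Aut) : G.eqCohomology →+* G.eqCohomology where
  toFun ξ := ⟨fun p => symMap (F.1.2.2.symm : L →ₗ[ℤ] L) (ξ.1 (F.1.1 p)), by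
    intro e
    obtain ⟨⟨a, b, c⟩, h1, h2, h3, h4⟩ := F
    dsimp only at *
    have h := ξ.2 (b e)
    rw [h1, h2, ← h4] at h
    have h' := map_dvd (symMap (c.symm : L →ₗ[ℤ] L)) h
    rw [symMap_ι, map_sub] at h'
    simpa using h'⟩
  map_one' := by ext p; simp
  map_mul' ξ η := by ext p; simp
  map_zero' := by ext p; simp
  map_add' ξ η := by ext p; simp

theorem posIdeal_le_comap (F : G.Aut) : G.posIdeal ≤ G.posIdeal.comap (eqPullback F) := by
  rw [posIdeal, Ideal.span_le]
  rintro _ ⟨f, hf, rfl⟩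
  exact Ideal.subset_span ⟨symMap (F.1.2.2.symm : L →ₗ[ℤ] L) f,
    by rw [algebraMapInv_symMap, hf], rfl⟩

/-- The induced action of an automorphism on graph cohomology. -/
def pullback (F : G.Aut) : G.Cohomology →+* G.Cohomology :=
  Ideal.quotientMap G.posIdeal (eqPullback F) (posIdeal_le_comap F)

/-- The induced action of an automorphism on rational graph cohomology `ℚ ⊗ H^*(Γ, α)`. -/
def rationalPullback (F : G.Aut) :
    ℚ ⊗[ℤ] G.Cohomology →+ ℚ ⊗[ℤ] G.Cohomology :=
  (LinearMap.lTensor ℚ (pullback F).toAddMonoidHom.toIntLinearMap).toAddMonoidHom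

theorem pullback_toCohomology (F : G.Aut) (ξ : G.eqCohomology) :
    pullback F (G.toCohomology ξ) = G.toCohomology (eqPullback F ξ) := rfl

theorem eqPullback_one (ξ : G.eqCohomology) : eqPullback (1 : G.Aut) ξ = ξ :=
  Subtype.ext (funext fun _ => symMap_one _)

theorem eqPullback_mul (F F' : G.Aut) (ξ : G.eqCohomology) :
    eqPullback (F * F') ξ = eqPullback F' (eqPullback F ξ) :=
  Subtype.ext (funext fun _ =>
    symMap_comp (F'.1.2.2.symm : L →ₗ[ℤ] L) (F.1.2.2.symm : L →ₗ[ℤ] L) _)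

theorem pullback_one (x : G.Cohomology) : pullback (1 : G.Aut) x = x := by
  obtain ⟨ξ, rfl⟩ := G.toCohomology_surjective x
  rw [pullback_toCohomology, eqPullback_one]

theorem pullback_mul (F F' : G.Aut) (x : G.Cohomology) :
    pullback (F * F') x = pullback F' (pullback F x) := by
  obtain ⟨ξ, rfl⟩ := G.toCohomology_surjective x
  simp only [pullback_toCohomology, eqPullback_mul]

theorem rationalPullback_tmul (F : G.Aut) (q : ℚ) (x : G.Cohomology) :
    rationalPullback F (q ⊗ₜ[ℤ] x) = q ⊗ₜ[ℤ] pullback F x := rfl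

theorem rationalPullback_one (y : ℚ ⊗[ℤ] G.Cohomology) :
    rationalPullback (1 : G.Aut) y = y := by
  induction y with
  | zero => rw [map_zero]
  | tmul q x => rw [rationalPullback_tmul, pullback_one]
  | add x y hx hy => rw [map_add, hx, hy]

theorem rationalPullback_mul (F F' : G.Aut) (y : ℚ ⊗[ℤ] G.Cohomology) :
    rationalPullback (F * F') y = rationalPullback F' (rationalPullback F y) := by
  induction y with
  | zero => simp only [map_zero]
  | tmul q x => simp only [rationalPullback_tmul, pullback_mul]
  | add x y hx hy => simp only [map_add, hx, hy]

variable (G)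

/-- The subgroup of automorphisms acting trivially on `H^*(Γ, α) ⊗ ℚ`. -/
def AutStar : Subgroup G.Aut where
  carrier := {F | ∀ y, rationalPullback F y = y}
  one_mem' := rationalPullback_one
  mul_mem' := fun {F F'} h h' y => by rw [rationalPullback_mul, h, h']
  inv_mem' := fun {F} h y => by
    have := rationalPullback_mul F F⁻¹ y
    rw [mul_inv_cancel, rationalPullback_one, h] at this
    exact this.symm

end GKMGraph

/-! ### Flags and Hessenberg varieties

The index set `[n] = {1, …, n}` is `Fin n`, shifted by one. -/

/-- A complete flag `V₁ ⊂ ⋯ ⊂ Vₙ` in `ℂⁿ`, with `space i` of dimension `i + 1`. -/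
@[ext]
structure CompleteFlag (n : ℕ) where
  space : Fin n → Submodule ℂ (Fin n → ℂ)
  mono : Monotone space
  finrank_space : ∀ i, Module.finrank ℂ (space i) = i + 1

/-- The flag whose `i`-th member is spanned by the first `i` columns of an invertible matrix. -/
def columnFlag {n : ℕ} (g : Matrix.GeneralLinearGroup (Fin n) ℂ) : CompleteFlag n where
  space i := Submodule.span ℂ (Set.range fun k : Set.Iic i => fun a => g.1 a k)
  mono := by
    intro i j hij
    apply Submodule.span_mono
    rintro _ ⟨⟨k, hk⟩, rfl⟩
    exact ⟨⟨k, le_trans hk hij⟩, rfl⟩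
  finrank_space i := by
    have h := Matrix.linearIndependent_cols_of_isUnit g.isUnit
    have h' := h.comp (fun k : Set.Iic i => (k : Fin n)) Subtype.val_injective
    have h2 := finrank_span_eq_card h'
    rw [show Fintype.card (Set.Iic i) = i + 1 by simp] at h2
    exact h2

/-- The usual topology of the flag variety `GLₙ(ℂ) / B`. -/
instance (n : ℕ) : TopologicalSpace (CompleteFlag n) :=
  TopologicalSpace.coinduced columnFlag inferInstance

/-- Hessenberg functions. -/
structure IsHessenbergFunction {n : ℕ} (h : Fin n → Fin n) : Prop where
  mono : Monotone h
  le_apply : ∀ j, j ≤ h j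

/-- A square matrix with distinct eigenvalues. -/
def IsRegularSemisimple {n : ℕ} (S : Matrix (Fin n) (Fin n) ℂ) : Prop :=
  S.charpoly.roots.Nodup

/-- The Hessenberg variety, as a subset of the flag variety. -/
def Hess {n : ℕ} (S : Matrix (Fin n) (Fin n) ℂ) (h : Fin n → Fin n) : Set (CompleteFlag n) :=
  {F | ∀ j, (F.space j).map S.mulVecLin ≤ F.space (h j)}

/-! ### The GKM graph of a regular semisimple Hessenberg variety -/

/-- The group `H²(BT)`: integer combinations `∑ aᵢ tᵢ` with `∑ aᵢ = 0`. -/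
abbrev WeightLattice (n : ℕ) : Type :=
  LinearMap.ker (∑ i, LinearMap.proj i : (Fin n → ℤ) →ₗ[ℤ] ℤ)

/-- The root `tₖ - tₗ`. -/
def root {n : ℕ} (k l : Fin n) : WeightLattice n :=
  ⟨Pi.single k 1 - Pi.single l 1, by simp⟩

/-- The pairs `(i, j)` with `j < i ≤ h(j)`. -/
abbrev HessPair {n : ℕ} (h : Fin n → Fin n) : Type :=
  {p : Fin n × Fin n // p.2 < p.1 ∧ p.1 ≤ h p.2}

theorem root_apply {n : ℕ} (k l a : Fin n) :
    (root k l : Fin n → ℤ) a = (if a = k then 1 else 0) - (if a = l then 1 else 0) := by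
  simp [root, Pi.single_apply]

theorem root_swap {n : ℕ} (k l : Fin n) : root l k = -root k l := by
  ext a; simp [root]

theorem root_indep {n : ℕ} (i j k l : Fin n) (hij : i ≠ j) (hkl : k ≠ l)
    (h1 : ¬(i = k ∧ j = l)) (h2 : ¬(i = l ∧ j = k)) :
    LinearIndependent ℤ ![root i j, root k l] := by
  rw [LinearIndependent.pair_iff]
  intro s t hst
  have H : ∀ a, s * ((if a = i then 1 else 0) - (if a = j then 1 else 0)) +
      t * ((if a = k then 1 else 0) - (if a = l then 1 else 0)) = 0 := by
    intro a
    have := congrFun (congrArg Subtype.val hst) a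
    simpa [root_apply] using this
  have hi := H i
  have hj := H j
  have hk := H k
  have hl := H l
  grind

/-- The GKM graph `(Γ_h, α_h)`. Its vertices are the permutations `w`; the pair `(w, (i, j))` with
`j < i ≤ h(j)` stands for the oriented edge from `w` to `w (i j)`, with label `t_{w i} - t_{w j}`. -/
def hessGraph {n : ℕ} (h : Fin n → Fin n) :
    GKMGraph (Equiv.Perm (Fin n)) (Equiv.Perm (Fin n) × HessPair h) (WeightLattice n) where
  init e := e.1
  term e := e.1 * Equiv.swap e.2.1.1 e.2.1.2
  bar e := (e.1 * Equiv.swap e.2.1.1 e.2.1.2, e.2)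
  bar_bar e := by simp [mul_assoc]
  bar_ne e he := by
    have h1 : e.1 * Equiv.swap e.2.1.1 e.2.1.2 = e.1 := congrArg Prod.fst he
    have h2 : Equiv.swap e.2.1.1 e.2.1.2 = 1 := by simpa using h1
    exact e.2.2.1.ne' (Equiv.swap_eq_one_iff.mp h2)
  init_bar e := rfl
  regular := by
    refine ⟨Nat.card (HessPair h), fun p => Nat.card_congr ?_⟩
    exact
      { toFun := fun e => e.1.2
        invFun := fun q => ⟨(p, q), rfl⟩
        left_inv := by rintro ⟨⟨w, q⟩, rfl⟩; rfl
        right_inv := fun q => rfl }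
  label e := root (e.1 e.2.1.1) (e.1 e.2.1.2)
  label_bar e := by simp [root_swap (e.1 e.2.1.1)]
  label_indep := by
    rintro ⟨w, ⟨⟨i, j⟩, hij, hij'⟩⟩ ⟨w', ⟨⟨k, l⟩, hkl, hkl'⟩⟩ hw hne
    dsimp only at *
    subst hw
    apply root_indep
    · simpa using hij.ne'
    · simpa using hkl.ne'
    · rintro ⟨h1, h2⟩
      apply hne
      simp_all
    · rintro ⟨h1, h2⟩
      have h1' := w.injective h1
      have h2' := w.injective h2
      subst h1' h2'
      exact lt_asymm hij hkl
  label_congr := by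
    rintro ⟨w, ⟨⟨i, j⟩, hij, hij'⟩⟩
    refine ⟨{ toFun := fun e => ⟨(w * Equiv.swap i j, e.1.2), rfl⟩
              invFun := fun e => ⟨(w, e.1.2), rfl⟩
              left_inv := fun e => Subtype.ext (Prod.ext e.2.symm rfl)
              right_inv := fun e => Subtype.ext (Prod.ext e.2.symm rfl) }, ?_⟩
    rintro ⟨⟨w', ⟨⟨k, l⟩, hkl⟩⟩, hw⟩
    change w' = w at hw
    subst hw
    dsimp only [Equiv.coe_fn_mk, Equiv.Perm.mul_apply]
    have key : ∀ m : Fin n, ∃ c : ℤ, ∀ a : Fin n,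
        ((if a = w' (Equiv.swap i j m) then 1 else 0) - (if a = w' m then 1 else 0) : ℤ) =
          c * ((if a = w' i then 1 else 0) - (if a = w' j then 1 else 0)) := by
      intro m
      by_cases hmi : m = i
      · subst hmi
        exact ⟨-1, fun a => by rw [Equiv.swap_apply_left]; ring⟩
      by_cases hmj : m = j
      · subst hmj
        exact ⟨1, fun a => by rw [Equiv.swap_apply_right]; ring⟩
      · exact ⟨0, fun a => by rw [Equiv.swap_apply_of_ne_of_ne hmi hmj]; ring⟩
    obtain ⟨c, hc⟩ := key k
    obtain ⟨d, hd⟩ := key l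
    refine ⟨c - d, ?_⟩
    ext a
    have h1 := hc a
    have h2 := hd a
    simp only [Submodule.coe_sub, Submodule.coe_smul, Pi.sub_apply, Pi.smul_apply, root_apply,
      smul_eq_mul]
    linear_combination h1 - h2

/-- The automorphism `tᵢ ↦ t_{σ(i)}` of `H²(BT)`. -/
def weightPerm {n : ℕ} (σ : Equiv.Perm (Fin n)) : WeightLattice n ≃ₗ[ℤ] WeightLattice n :=
  (LinearEquiv.funCongrLeft ℤ ℤ σ.symm).ofSubmodules _ _ (by
    ext a
    rw [Submodule.mem_map_equiv]
    simp only [LinearMap.mem_ker, LinearMap.sum_apply, LinearMap.proj_apply]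
    have : ∑ i, ((LinearEquiv.funCongrLeft ℤ ℤ σ.symm).symm a) i = ∑ i, a i :=
      Equiv.sum_comp σ a
    rw [this])

theorem weightPerm_root {n : ℕ} (σ : Equiv.Perm (Fin n)) (k l : Fin n) :
    weightPerm σ (root k l) = root (σ k) (σ l) := by
  ext a
  have : (weightPerm σ (root k l) : Fin n → ℤ) a = (root k l : Fin n → ℤ) (σ.symm a) := rfl
  rw [this, root_apply, root_apply]
  simp [Equiv.symm_apply_eq]

/-- The automorphism `Φ_σ` of `(Γ_h, α_h)`: `w ↦ σ w` on vertices and `tᵢ ↦ t_{σ(i)}` on labels. -/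
def hessAut {n : ℕ} (h : Fin n → Fin n) (σ : Equiv.Perm (Fin n)) : (hessGraph h).Aut :=
  ⟨(Equiv.mulLeft σ, (Equiv.mulLeft σ).prodCongr (Equiv.refl _), weightPerm σ),
    fun _ => rfl, fun _ => by simp [hessGraph, mul_assoc], fun _ => by simp [hessGraph, mul_assoc],
    fun _ => by simp [hessGraph, weightPerm_root]⟩

end

/-!
`Hess(S, h)` is the whole flag variety exactly when `i ≤ h j` for all `i, j` (`hess_eq_univ`,
`hess_ne_univ`), so the theorem reduces to three facts about the graph `(Γ_h, α_h)`, where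
connectedness of `Hess(S, h)` enters only through the inequality `j < h j` for all `j` but the
last (`lt_apply_of_isConnected_hess`: if `h j = j`, then `V_j` is spanned by eigenvectors, and the
flags with a given eigenvector in `V_j` form a closed and open subset). It makes the graph
connected, since adjacent transpositions generate the symmetric group.

*An automorphism `F = (φ, ϕ)` trivial on rational cohomology is some `Φ_σ`.* The class `w ↦
t_{w(i)} - t_{w(j)}` is changed by `F`, after multiplication by a nonzero integer, by an element
of the ideal generated by the constants of positive degree, which in degree two consists of
constant maps because the graph is connected. Both the class and its pullback sum to zero over all
vertices, so the constant is zero. Thus `ϕ(t_{w(i)} - t_{w(j)}) = t_{φ(w)(i)} - t_{φ(w)(j)}` for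
all `w, i, j` (`map_root_of_mem_autStar`), and `w = 1` shows that `F = Φ_σ` with `σ = φ(1)`.

*On the full flag variety every `Φ_σ` acts trivially.* For a transposition `s = (a b)` the
vertices `w` and `s w` are always adjacent, so `Φ_s ξ - ξ` is divisible by `t_a - t_b` at each
vertex; the quotient, a left divided difference, is again a class
(`eqPullback_hessAut_swap_sub_mem`).

*Otherwise only `Φ_1` does.* Now `h` does not send the first index `a` to the last index `z`. The
set `{w | w a = k}` has a class `ξ_k` given at its vertices by the product of the labels leaving
it, and `Φ_σ` pulls `ξ_k` back to `ξ_{σ⁻¹ k}`. Similarly `{w | w z = l}` carries a class `η_l`,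
whose product with `ξ_k` is the product of all labels on `{w | w a = k, w z = l}`: the labels
leaving the second set are all among the factors not used in `ξ_k`, because no edge joins `w` to
`w (a z)`. By localization the integral of `ξ_k η_l` is, up to sign, the number of these vertices,
which is nonzero for `k ≠ l`, while `ξ_l η_l = 0`. Integration takes polynomial values
(`rootProd_dvd_integral`), hence maps the ideal generated by the constants of positive degree to
polynomials without constant term (`integral_of_mem_posIdeal`). So `ξ_k` and `ξ_l` differ in
rational cohomology.
-/

open SymmetricAlgebra (ι algebraMapInv)
open Equiv (swap Perm)

/-! ### Symmetric algebras and roots -/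

section Roots

variable {n : ℕ}

instance SymmetricAlgebra.isDomain_of_free {L : Type} [AddCommGroup L] [Module.Free ℤ L] :
    IsDomain (SymmetricAlgebra ℤ L) :=
  (SymmetricAlgebra.equivMvPolynomial (Module.Free.chooseBasis ℤ L)).toMulEquiv.isDomain _

theorem SymmetricAlgebra.prime_ι_basis {L κ : Type} [AddCommGroup L] (b : Module.Basis κ ℤ L)
    (i : κ) : Prime (ι ℤ L (b i)) := by
  rw [← MulEquiv.prime_iff (SymmetricAlgebra.equivMvPolynomial b),
    SymmetricAlgebra.equivMvPolynomial_ι_apply]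
  exact MvPolynomial.X_prime

theorem sum_weight_eq_zero (v : WeightLattice n) : ∑ i, (v : Fin n → ℤ) i = 0 := by
  simpa only [LinearMap.sum_apply, LinearMap.proj_apply] using LinearMap.mem_ker.1 v.2

/-- The coordinates of a weight with respect to the roots `root a c`, for fixed `a`. -/
noncomputable def rootCoords (a : Fin n) : WeightLattice n ≃ₗ[ℤ] ({c : Fin n // c ≠ a} → ℤ) where
  toFun v c := -(v : Fin n → ℤ) c
  map_add' v w := by ext c; simp; ring
  map_smul' r v := by ext c; simp
  invFun f := ∑ c, f c • root a c
  left_inv v := by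
    ext x
    have h0 := sum_weight_eq_zero v
    rw [← Finset.add_sum_erase _ _ (Finset.mem_univ a)] at h0
    have h1 : ∑ c : {c : Fin n // c ≠ a}, (v : Fin n → ℤ) c =
        ∑ c ∈ Finset.univ.erase a, (v : Fin n → ℤ) c :=
      (Finset.sum_subtype _ (by simp) _).symm
    rw [← h1] at h0
    simp only [AddSubmonoidClass.coe_finsetSum, Submodule.coe_smul, Finset.sum_apply,
      Pi.smul_apply, root_apply, smul_eq_mul]
    by_cases hx : x = a
    · subst hx
      have : ∀ c : {c : Fin n // c ≠ x}, x ≠ c := fun c => c.2.symm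
      simp only [this, if_true, if_false, sub_zero, mul_one, Finset.sum_neg_distrib]
      linarith
    · rw [Finset.sum_eq_single ⟨x, hx⟩]
      · simp [hx]
      · intro c _ hc
        have : x ≠ c := fun h => hc (Subtype.ext h.symm)
        simp [hx, this]
      · simp
  right_inv f := by
    ext c
    simp only [AddSubmonoidClass.coe_finsetSum, Submodule.coe_smul, Finset.sum_apply,
      Pi.smul_apply, root_apply, smul_eq_mul]
    rw [Finset.sum_eq_single c]
    · simp [c.2]
    · intro d _ hd
      have : (c : Fin n) ≠ d := fun h => hd (Subtype.ext h.symm)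
      simp [this, c.2]
    · simp

/-- The basis of `WeightLattice n` consisting of the roots `root a c`, for fixed `a`. -/
noncomputable def rootBasis (a : Fin n) : Module.Basis {c : Fin n // c ≠ a} ℤ (WeightLattice n) :=
  Module.Basis.ofEquivFun (rootCoords a)

theorem rootBasis_apply (a : Fin n) (b : {c : Fin n // c ≠ a}) : rootBasis a b = root a b := by
  rw [rootBasis, Module.Basis.coe_ofEquivFun, LinearEquiv.symm_apply_eq]
  ext c
  change _ = -(root a b : Fin n → ℤ) c
  simp [root_apply, c.2, Pi.single_apply, Subtype.ext_iff]

theorem weight_hom_ext {M : Type} [AddCommGroup M] {f g : WeightLattice n →ₗ[ℤ] M}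
    (hfg : ∀ a b, f (root a b) = g (root a b)) : f = g := by
  rcases isEmpty_or_nonempty (Fin n) with hn | ⟨⟨a⟩⟩
  · ext v
    rw [Subsingleton.elim v 0, map_zero, map_zero]
  · exact (rootBasis a).ext fun b => by rw [rootBasis_apply]; exact hfg a b

theorem prime_root {a b : Fin n} (hab : a ≠ b) : Prime (ι ℤ (WeightLattice n) (root a b)) := by
  have h := SymmetricAlgebra.prime_ι_basis (rootBasis a) ⟨b, hab.symm⟩
  rwa [rootBasis_apply] at h

theorem SymmetricAlgebra.eq_zero_of_ι_dvd_ι {L : Type} [AddCommGroup L] {x y : L} (f : L →ₗ[ℤ] ℤ)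
    (hx : f x = 0) (hd : ι ℤ L x ∣ ι ℤ L y) : f y = 0 := by
  have := map_dvd (SymmetricAlgebra.lift f) hd
  rwa [SymmetricAlgebra.lift_ι_apply, SymmetricAlgebra.lift_ι_apply, hx, zero_dvd_iff] at this

theorem not_root_dvd_root {a b c d : Fin n} (hcd : c ≠ d) (h1 : ¬(a = c ∧ b = d))
    (h2 : ¬(a = d ∧ b = c)) :
    ¬ ι ℤ (WeightLattice n) (root a b) ∣ ι ℤ (WeightLattice n) (root c d) := by
  intro hd
  have key : ∀ x, (root a b : Fin n → ℤ) x = 0 → (root c d : Fin n → ℤ) x = 0 := fun x hx =>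
    SymmetricAlgebra.eq_zero_of_ι_dvd_ι (LinearMap.proj x ∘ₗ Submodule.subtype _) hx hd
  have hc := key c
  have hd := key d
  simp only [root_apply] at hc hd
  grind

theorem root_injective {a b c d : Fin n} (hab : a ≠ b) (h : root a b = root c d) :
    a = c ∧ b = d := by
  have key : ∀ x, (root a b : Fin n → ℤ) x = (root c d : Fin n → ℤ) x := fun x => by rw [h]
  have ha := key a
  have hb := key b
  simp only [root_apply] at ha hb
  grind

/-- The reflection in a root acts trivially modulo that root. -/
theorem root_dvd_symMap_sub (a b : Fin n) (x : SymmetricAlgebra ℤ (WeightLattice n)) :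
    ι ℤ _ (root a b) ∣ symMap (weightPerm (swap a b) : WeightLattice n →ₗ[ℤ] WeightLattice n) x
      - x := by
  rw [← Ideal.mem_span_singleton, ← Ideal.Quotient.mk_eq_mk_iff_sub_mem]
  set I : Ideal (SymmetricAlgebra ℤ (WeightLattice n)) := Ideal.span {ι ℤ _ (root a b)}
  have : (Ideal.Quotient.mkₐ ℤ I).comp
      (symMap (weightPerm (swap a b) : WeightLattice n →ₗ[ℤ] WeightLattice n)) =
      Ideal.Quotient.mkₐ ℤ I := by
    apply SymmetricAlgebra.algHom_ext
    ext v : 1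
    change Ideal.Quotient.mk I (symMap _ (ι ℤ _ v)) = Ideal.Quotient.mk I (ι ℤ _ v)
    rw [symMap_ι]
    rw [Ideal.Quotient.mk_eq_mk_iff_sub_mem, Ideal.mem_span_singleton]
    refine ⟨((v : Fin n → ℤ) b - (v : Fin n → ℤ) a : ℤ), ?_⟩
    rw [← map_sub, mul_comm, ← zsmul_eq_mul, ← map_zsmul]
    congr 1
    ext x
    have : (weightPerm (swap a b) v : Fin n → ℤ) x = (v : Fin n → ℤ) (swap a b x) := rfl
    simp only [LinearEquiv.coe_coe, Submodule.coe_sub, Pi.sub_apply, this, Submodule.coe_smul,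
      Pi.smul_apply, root_apply, smul_eq_mul, Equiv.swap_apply_def]
    grind
  exact DFunLike.congr_fun this x

theorem root_dvd_root_swap_sub (a b c d : Fin n) :
    ι ℤ (WeightLattice n) (root a b) ∣
      ι ℤ _ (root (swap a b c) (swap a b d)) - ι ℤ _ (root c d) := by
  have := root_dvd_symMap_sub a b (ι ℤ _ (root c d))
  rwa [symMap_ι, LinearEquiv.coe_coe, weightPerm_root] at this

end Roots

/-! ### Automorphisms acting trivially on rational graph cohomology -/

namespace GKMGraph

variable {V E L : Type} [Finite V] [Finite E] [AddCommGroup L]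
  [Module.Free ℤ L] [Module.Finite ℤ L] {G : GKMGraph V E L}

theorem mem_autStar_of_sub_mem_posIdeal {F : G.Aut}
    (h : ∀ ξ, eqPullback F ξ - ξ ∈ G.posIdeal) : F ∈ G.AutStar := by
  intro y
  induction y with
  | zero => rw [map_zero]
  | add x y hx hy => rw [map_add, hx, hy]
  | tmul q x =>
    obtain ⟨ξ, rfl⟩ := G.toCohomology_surjective x
    rw [rationalPullback_tmul, pullback_toCohomology]
    congr 1
    exact (Ideal.Quotient.mk_eq_mk_iff_sub_mem _ _).2 (h ξ)

/-- The kernel of `H^*(Γ, α) → ℚ ⊗ H^*(Γ, α)` is the torsion subgroup. -/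
theorem exists_zsmul_sub_mem_posIdeal {F : G.Aut} (hF : F ∈ G.AutStar) (ξ : G.eqCohomology) :
    ∃ N : ℤ, N ≠ 0 ∧ N • (eqPullback F ξ - ξ) ∈ G.posIdeal := by
  have h := hF (1 ⊗ₜ[ℤ] G.toCohomology ξ)
  rw [rationalPullback_tmul, pullback_toCohomology, ← sub_eq_zero, ← TensorProduct.tmul_sub] at h
  obtain ⟨N, hN⟩ := (IsLocalizedModule.eq_zero_iff (nonZeroDivisors ℤ)
    (TensorProduct.mk ℤ ℚ G.Cohomology 1)).1 h
  refine ⟨N, nonZeroDivisors.coe_ne_zero N, ?_⟩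
  rw [← Ideal.Quotient.eq_zero_iff_mem]
  change G.toCohomology _ = 0
  rw [map_zsmul, map_sub]
  exact hN

end GKMGraph

/-! ### Classes in the equivariant cohomology of Hessenberg graphs -/

section HessGraph

variable {n : ℕ} {h : Fin n → Fin n}

theorem hessAut_one : hessAut h 1 = 1 := by
  refine Subtype.ext (Prod.ext ?_ (Prod.ext ?_ ?_))
  · ext; simp [hessAut]
  · ext <;> simp [hessAut]
  · rfl

theorem hessAut_mul (σ τ : Perm (Fin n)) : hessAut h (σ * τ) = hessAut h σ * hessAut h τ := by
  refine Subtype.ext (Prod.ext ?_ (Prod.ext ?_ ?_))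
  · ext; simp [hessAut]
  · ext <;> simp [hessAut]
  · rfl

theorem root_dvd_sub_swap_mul {ξ : Perm (Fin n) → SymmetricAlgebra ℤ (WeightLattice n)}
    (hξ : ξ ∈ (hessGraph h).eqCohomology) {w : Perm (Fin n)} {a b : Fin n}
    (hab : (w⁻¹ b < w⁻¹ a ∧ w⁻¹ a ≤ h (w⁻¹ b)) ∨ (w⁻¹ a < w⁻¹ b ∧ w⁻¹ b ≤ h (w⁻¹ a))) :
    ι ℤ _ (root a b) ∣ ξ w - ξ (swap a b * w) := by
  rcases hab with hab | hab
  · have := hξ (w, ⟨(w⁻¹ a, w⁻¹ b), hab⟩)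
    simpa [hessGraph, Equiv.mul_swap_eq_swap_mul] using this
  · have := hξ (w, ⟨(w⁻¹ b, w⁻¹ a), hab⟩)
    rw [root_swap b a, map_neg, neg_dvd, Equiv.swap_comm]
    simpa [hessGraph, Equiv.mul_swap_eq_swap_mul] using this

theorem eqPullback_hessAut_apply (σ w : Perm (Fin n)) (ξ : (hessGraph h).eqCohomology) :
    (GKMGraph.eqPullback (hessAut h σ) ξ).1 w =
      symMap (weightPerm σ⁻¹ : WeightLattice n →ₗ[ℤ] WeightLattice n) (ξ.1 (σ * w)) := rfl

/-- For the full flag variety, `Φ_s ξ - ξ` is a multiple of the root of the transposition `s`: the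
quotient is the left divided difference of `ξ`, again an equivariant class. -/
theorem eqPullback_hessAut_swap_sub_mem (hfull : ∀ i j, i ≤ h j) {a b : Fin n} (hab : a ≠ b)
    (ξ : (hessGraph h).eqCohomology) :
    GKMGraph.eqPullback (hessAut h (swap a b)) ξ - ξ ∈ (hessGraph h).posIdeal := by
  set s : SymmetricAlgebra ℤ (WeightLattice n) →ₐ[ℤ] SymmetricAlgebra ℤ (WeightLattice n) :=
    symMap (weightPerm (swap a b) : WeightLattice n →ₗ[ℤ] WeightLattice n) with hs
  set ζ : (hessGraph h).eqCohomology := GKMGraph.eqPullback (hessAut h (swap a b)) ξ - ξ with hζ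
  have hss : ∀ x, s (s x) = x := by
    intro x
    have : (weightPerm (swap a b) : WeightLattice n →ₗ[ℤ] WeightLattice n) ∘ₗ
        (weightPerm (swap a b) : WeightLattice n →ₗ[ℤ] WeightLattice n) = LinearMap.id := by
      ext v x
      change (v : Fin n → ℤ) (swap a b (swap a b x)) = _
      simp
    rw [hs, ← symMap_comp, this, symMap_one]
  have hζw : ∀ w, ζ.1 w = s (ξ.1 (swap a b * w)) - ξ.1 w := by
    intro w
    rw [hζ]
    change (GKMGraph.eqPullback (hessAut h (swap a b)) ξ).1 w - ξ.1 w = _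
    rw [eqPullback_hessAut_apply, Equiv.swap_inv]
  have hdvd : ∀ w, ι ℤ _ (root a b) ∣ ζ.1 w := by
    intro w
    have h1 := root_dvd_symMap_sub a b (ξ.1 (swap a b * w))
    have h2 : ι ℤ _ (root a b) ∣ ξ.1 w - ξ.1 (swap a b * w) := by
      apply root_dvd_sub_swap_mul ξ.2
      rcases lt_or_gt_of_ne (w⁻¹.injective.ne hab) with hlt | hlt
      · exact Or.inr ⟨hlt, hfull _ _⟩
      · exact Or.inl ⟨hlt, hfull _ _⟩
    rw [hζw]
    convert dvd_sub h1 h2 using 1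
    ring
  choose η hη using hdvd
  have hr : ι ℤ _ (root a b) ≠ 0 := (prime_root hab).ne_zero
  have hsr : s (ι ℤ _ (root a b)) = -ι ℤ _ (root a b) := by
    rw [hs, symMap_ι, LinearEquiv.coe_coe, weightPerm_root, Equiv.swap_apply_left,
      Equiv.swap_apply_right, root_swap, map_neg]
  have hηs : ∀ w, η (swap a b * w) = s (η w) := by
    intro w
    apply mul_left_cancel₀ hr
    rw [← hη, hζw, Equiv.swap_mul_self_mul]
    have h1 : s (ζ.1 w) = ξ.1 (swap a b * w) - s (ξ.1 w) := by rw [hζw, map_sub, hss]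
    rw [hη, map_mul, hsr] at h1
    linear_combination h1
  have hηmem : η ∈ (hessGraph h).eqCohomology := by
    rintro ⟨w, ⟨⟨i, j⟩, hji, hij⟩⟩
    change ι ℤ _ (root (w i) (w j)) ∣ η w - η (w * swap i j)
    have hne : w i ≠ w j := w.injective.ne hji.ne'
    by_cases h1 : w i = a ∧ w j = b
    · rw [Equiv.mul_swap_eq_swap_mul, h1.1, h1.2, hηs, ← dvd_neg, neg_sub]
      exact root_dvd_symMap_sub a b _
    by_cases h2 : w i = b ∧ w j = a
    · rw [Equiv.mul_swap_eq_swap_mul, h2.1, h2.2, Equiv.swap_comm, hηs, ← dvd_neg, neg_sub,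
        root_swap, map_neg, neg_dvd]
      exact root_dvd_symMap_sub a b _
    have h3 : ι ℤ _ (root (w i) (w j)) ∣ ζ.1 w - ζ.1 (w * swap i j) :=
      ζ.2 (w, ⟨(i, j), hji, hij⟩)
    rw [hη, hη, ← mul_sub] at h3
    exact ((prime_root hne).dvd_or_dvd h3).resolve_left (not_root_dvd_root hab h1 h2)
  have : ζ = (⟨η, hηmem⟩ : (hessGraph h).eqCohomology) *
      (hessGraph h).const (ι ℤ _ (root a b)) := by
    ext w : 2
    exact (hη w).trans (mul_comm _ _)
  rw [this]
  exact Ideal.mul_mem_left _ _ (Ideal.subset_span ⟨_, SymmetricAlgebra.algebraMapInv_ι _, rfl⟩)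

theorem hessAut_mem_autStar (hfull : ∀ i j, i ≤ h j) (σ : Perm (Fin n)) :
    hessAut h σ ∈ (hessGraph h).AutStar := by
  induction σ using Equiv.Perm.swap_induction_on with
  | one => rw [hessAut_one]; exact one_mem _
  | swap_mul f x y hxy hf =>
    rw [hessAut_mul]
    exact mul_mem (GKMGraph.mem_autStar_of_sub_mem_posIdeal
      (eqPullback_hessAut_swap_sub_mem hfull hxy)) hf

end HessGraph

/-! ### First-order jets of classes -/

/-- The algebra map from `Sym(L)` to the dual numbers extending `v ↦ f(v) ε`: it records the
constant term and the value of `f` on the linear term. -/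
noncomputable def oneJet {L : Type} [AddCommGroup L] (f : L →ₗ[ℤ] ℤ) :
    SymmetricAlgebra ℤ L →ₐ[ℤ] DualNumber ℤ :=
  SymmetricAlgebra.lift (TrivSqZeroExt.inrHom ℤ ℤ ∘ₗ f)

theorem oneJet_ι {L : Type} [AddCommGroup L] (f : L →ₗ[ℤ] ℤ) (v : L) :
    oneJet f (ι ℤ L v) = TrivSqZeroExt.inr (f v) :=
  SymmetricAlgebra.lift_ι_apply _ _

theorem fst_oneJet {L : Type} [AddCommGroup L] (f : L →ₗ[ℤ] ℤ) (x : SymmetricAlgebra ℤ L) :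
    (oneJet f x).fst = algebraMapInv x := by
  have : (TrivSqZeroExt.fstHom ℤ ℤ ℤ).comp (oneJet f) = algebraMapInv := by
    apply SymmetricAlgebra.algHom_ext
    ext v
    change (oneJet f (ι ℤ L v)).fst = algebraMapInv (ι ℤ L v)
    rw [oneJet_ι, SymmetricAlgebra.algebraMapInv_ι, TrivSqZeroExt.fst_inr]
  exact DFunLike.congr_fun this x

namespace GKMGraph

variable {V E L : Type} [Finite V] [Finite E] [AddCommGroup L]
  [Module.Free ℤ L] [Module.Finite ℤ L] {G : GKMGraph V E L}

/-- On a connected graph, the linear part of a class that vanishes in ordinary cohomology is the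
same at all vertices, because the degree zero part of any class is. -/
theorem exists_oneJet_eq_inr_of_mem_posIdeal
    (hG : ∀ c : V → ℤ, (∀ e, c (G.init e) = c (G.term e)) → ∀ p q, c p = c q)
    (f : L →ₗ[ℤ] ℤ) {ξ : G.eqCohomology} (hξ : ξ ∈ G.posIdeal) :
    ∃ k : ℤ, ∀ p, oneJet f (ξ.1 p) = TrivSqZeroExt.inr k := by
  refine Submodule.span_induction ?_ ?_ ?_ ?_ hξ
  · rintro _ ⟨x, hx, rfl⟩
    refine ⟨(oneJet f x).snd, fun p => TrivSqZeroExt.ext ?_ rfl⟩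
    rw [← fst_oneJet f] at hx
    exact hx
  · exact ⟨0, fun p => map_zero _⟩
  · rintro x y _ _ ⟨k, hk⟩ ⟨l, hl⟩
    refine ⟨k + l, fun p => ?_⟩
    rw [TrivSqZeroExt.inr_add, ← hk p, ← hl p]
    exact map_add _ _ _
  · rintro a x _ ⟨k, hk⟩
    have hc := hG (fun p => algebraMapInv (a.1 p)) fun e => by
      have h1 := map_dvd (algebraMapInv (R := ℤ) (M := L)) (a.2 e)
      rw [SymmetricAlgebra.algebraMapInv_ι, zero_dvd_iff, map_sub] at h1
      exact sub_eq_zero.1 h1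
    rcases isEmpty_or_nonempty V with hV | ⟨⟨p₀⟩⟩
    · exact ⟨0, fun p => hV.elim p⟩
    refine ⟨algebraMapInv (a.1 p₀) * k, fun p => ?_⟩
    change oneJet f (a.1 p * x.1 p) = _
    rw [map_mul, hk p]
    ext
    · simp
    · simp [fst_oneJet, hc p p₀]

end GKMGraph

section Rigidity

variable {n : ℕ} {h : Fin n → Fin n}

/-- The GKM graph is connected: adjacent transpositions generate the symmetric group. -/
theorem hessGraph_connected (hc : ∀ j : Fin n, (j : ℕ) + 1 < n → j < h j)
    {α : Type} (c : Perm (Fin n) → α)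
    (hcc : ∀ e, c ((hessGraph h).init e) = c ((hessGraph h).term e)) (p q : Perm (Fin n)) :
    c p = c q := by
  obtain _ | m := n
  · rw [Subsingleton.elim p q]
  have key : ∀ x : Perm (Fin (m + 1)), ∀ w, c (w * x) = c w := by
    intro x
    have hx : x ∈ Submonoid.closure (Set.range fun i : Fin m ↦ swap i.castSucc i.succ) := by
      rw [Equiv.Perm.mclosure_swap_castSucc_succ]; trivial
    induction hx using Submonoid.closure_induction with
    | mem x hx =>
      obtain ⟨i, rfl⟩ := hx
      intro w
      change c (w * swap i.castSucc i.succ) = c w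
      have hi : i.castSucc < h i.castSucc := hc _ (by simp)
      have := hcc (w, ⟨(i.succ, i.castSucc), Fin.castSucc_lt_succ,
        Fin.castSucc_lt_iff_succ_le.1 hi⟩)
      rw [show swap i.castSucc i.succ = swap i.succ i.castSucc from Equiv.swap_comm _ _]
      exact this.symm
    | one => simp
    | mul x y _ _ hx hy => intro w; rw [← mul_assoc, hy, hx]
  rw [← one_mul p, ← one_mul q, key, key]

/-- The degree two class `w ↦ t_{w(i)} - t_{w(j)}`. -/
noncomputable def rootClass (h : Fin n → Fin n) (i j : Fin n) : (hessGraph h).eqCohomology :=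
  ⟨fun w => ι ℤ _ (root (w i) (w j)), by
    rintro ⟨w, ⟨⟨k, l⟩, hkl⟩⟩
    change ι ℤ _ (root (w k) (w l)) ∣
      ι ℤ _ (root (w i) (w j)) - ι ℤ _ (root ((w * swap k l) i) ((w * swap k l) j))
    rw [Equiv.mul_swap_eq_swap_mul, ← dvd_neg, neg_sub]
    exact root_dvd_root_swap_sub _ _ _ _⟩

theorem sum_perm_root (i j : Fin n) : ∑ w : Perm (Fin n), root (w i) (w j) = 0 := by
  have h1 := Equiv.sum_comp (Equiv.mulRight (swap i j)) fun w : Perm (Fin n) => root (w i) (w j)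
  simp only [Equiv.coe_mulRight, Equiv.Perm.mul_apply, Equiv.swap_apply_left,
    Equiv.swap_apply_right] at h1
  rw [Finset.sum_congr rfl fun w _ => root_swap (w i) (w j), Finset.sum_neg_distrib] at h1
  ext a
  exact self_eq_neg.1 (congrArg (fun v : WeightLattice n => (v : Fin n → ℤ) a) h1.symm)

/-- An automorphism acting trivially on rational cohomology preserves the classes `rootClass i j` on
the nose: it changes them by a constant, which vanishes since both have average zero. -/
theorem map_root_of_mem_autStar (hc : ∀ j : Fin n, (j : ℕ) + 1 < n → j < h j)
    {F : (hessGraph h).Aut} (hF : F ∈ (hessGraph h).AutStar) (w : Perm (Fin n)) (i j : Fin n) :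
    F.1.2.2 (root (w i) (w j)) = root (F.1.1 w i) (F.1.1 w j) := by
  obtain ⟨N, hN, hmem⟩ := GKMGraph.exists_zsmul_sub_mem_posIdeal hF (rootClass h i j)
  set g : Perm (Fin n) → WeightLattice n := fun w =>
    F.1.2.2.symm (root (F.1.1 w i) (F.1.1 w j)) - root (w i) (w j) with hg
  have hsum : ∑ w, g w = 0 := by
    rw [hg, Finset.sum_sub_distrib, sum_perm_root, ← map_sum,
      Equiv.sum_comp F.1.1 fun w : Perm (Fin n) => root (w i) (w j), sum_perm_root, map_zero,
      sub_zero]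
  have hgw : ∀ w, (N • (GKMGraph.eqPullback F (rootClass h i j) - rootClass h i j)).1 w =
      ι ℤ _ (N • g w) := by
    intro w
    change N • (symMap _ (ι ℤ _ (root (F.1.1 w i) (F.1.1 w j))) - ι ℤ _ (root (w i) (w j))) = _
    rw [symMap_ι, map_zsmul, ← map_sub]
    rfl
  have hzero : g w = 0 := by
    ext a
    set f : WeightLattice n →ₗ[ℤ] ℤ := LinearMap.proj a ∘ₗ Submodule.subtype _
    change f (g w) = 0
    obtain ⟨k, hk⟩ := GKMGraph.exists_oneJet_eq_inr_of_mem_posIdeal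
      (fun c hcc => hessGraph_connected hc c hcc) f hmem
    have hk' : ∀ w, N * f (g w) = k := by
      intro w
      have := hk w
      rw [hgw, oneJet_ι, map_zsmul, smul_eq_mul] at this
      exact TrivSqZeroExt.inr_injective this
    have hk0 : ∑ w, N * f (g w) = 0 := by rw [← Finset.mul_sum, ← map_sum, hsum, map_zero, mul_zero]
    rw [Finset.sum_congr rfl fun w _ => hk' w, Finset.sum_const, smul_eq_zero] at hk0
    have hk00 : k = 0 := hk0.resolve_left (Finset.card_ne_zero_of_mem (Finset.mem_univ w))
    have := hk' w
    rw [hk00] at this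
    exact (mul_eq_zero.1 this).resolve_left hN
  rw [hg, sub_eq_zero, LinearEquiv.symm_apply_eq] at hzero
  exact hzero.symm

theorem eq_hessAut_of_mem_autStar (hc : ∀ j : Fin n, (j : ℕ) + 1 < n → j < h j)
    {F : (hessGraph h).Aut} (hF : F ∈ (hessGraph h).AutStar) : F = hessAut h (F.1.1 1) := by
  have key := map_root_of_mem_autStar hc hF
  set σ := F.1.1 1 with hσ
  have hroot : ∀ a b, F.1.2.2 (root a b) = root (σ a) (σ b) := fun a b => key 1 a b
  have hvert : ∀ w, F.1.1 w = σ * w := by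
    intro w
    ext i
    rcases subsingleton_or_nontrivial (Fin n) with hn | hn
    · rw [Subsingleton.elim (F.1.1 w i)]
    obtain ⟨j, hj⟩ := exists_ne i
    have h1 := key w i j
    rw [hroot] at h1
    rw [← (root_injective (σ.injective.ne (w.injective.ne hj.symm)) h1).1]
    rfl
  refine Subtype.ext (Prod.ext ?_ (Prod.ext ?_ ?_))
  · exact Equiv.ext hvert
  · ext1 e
    have h1 : (F.1.2.1 e).1 = σ * e.1 := (F.2.1 e).trans (hvert _)
    have h2 : F.1.2.2 (root (e.1 e.2.1.1) (e.1 e.2.1.2)) =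
        root ((F.1.2.1 e).1 (F.1.2.1 e).2.1.1) ((F.1.2.1 e).1 (F.1.2.1 e).2.1.2) := F.2.2.2.2 e
    rw [hroot, h1] at h2
    obtain ⟨h3, h4⟩ := root_injective
      (σ.injective.ne (e.1.injective.ne e.2.2.1.ne')) h2
    refine Prod.ext h1 (Subtype.ext (Prod.ext ?_ ?_))
    · exact ((σ * e.1).injective h3).symm
    · exact ((σ * e.1).injective h4).symm
  · apply LinearEquiv.toLinearMap_injective
    apply weight_hom_ext
    intro a b
    exact (hroot a b).trans (weightPerm_root σ a b).symm

end Rigidity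

/-! ### Integration over the vertices -/

section Integration

variable {n : ℕ} {h : Fin n → Fin n}

/-- The product of the roots `t_{w(i)} - t_{w(j)}` over a set of pairs `(i, j)`. -/
noncomputable def rootProd (s : Finset (Fin n × Fin n)) (w : Perm (Fin n)) :
    SymmetricAlgebra ℤ (WeightLattice n) :=
  ∏ p ∈ s, ι ℤ _ (root (w p.1) (w p.2))

/-- The pairs `(i, j)` with `j < i`. -/
def descendingPairs (n : ℕ) : Finset (Fin n × Fin n) := Finset.univ.filter fun p => p.2 < p.1

/-- The pairs `(i, j)` with `j < i ≤ h(j)`. -/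
def hessPairs (h : Fin n → Fin n) : Finset (Fin n × Fin n) :=
  (descendingPairs n).filter fun p => p.1 ≤ h p.2

/-- The pairs `(i, j)` with `j < i` and `h(j) < i`. -/
def nonHessPairs (h : Fin n → Fin n) : Finset (Fin n × Fin n) :=
  (descendingPairs n).filter fun p => ¬ p.1 ≤ h p.2

theorem rootProd_mem_eqCohomology (s : Finset (Fin n × Fin n)) :
    rootProd s ∈ (hessGraph h).eqCohomology := by
  have : rootProd s = (∏ p ∈ s, (rootClass h p.1 p.2).1) := by
    ext w
    rw [Finset.prod_apply]
    rfl
  rw [this]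
  exact prod_mem fun p _ => (rootClass h p.1 p.2).2

theorem rootProd_hessPairs_mul (w : Perm (Fin n)) :
    rootProd (hessPairs h) w * rootProd (nonHessPairs h) w = rootProd (descendingPairs n) w :=
  Finset.prod_filter_mul_prod_filter_not _ _ _

/-- The Vandermonde product is antisymmetric. -/
theorem rootProd_descendingPairs (w : Perm (Fin n)) :
    rootProd (descendingPairs n) w = (Equiv.Perm.sign w : ℤ) * rootProd (descendingPairs n) 1 := by
  rcases isEmpty_or_nonempty (Fin n) with hn | ⟨⟨a⟩⟩
  · rw [Subsingleton.elim w 1]; simp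
  set v : Fin n → SymmetricAlgebra ℤ (WeightLattice n) := fun c => ι ℤ _ (root c a) with hv
  have key : ∀ w : Perm (Fin n), rootProd (descendingPairs n) w =
      (Matrix.vandermonde fun i => v (w i)).det := by
    intro w
    rw [Matrix.det_vandermonde, rootProd, descendingPairs, Finset.prod_filter,
      Fintype.prod_prod_type_right]
    refine Finset.prod_congr rfl fun j _ => ?_
    rw [← Finset.prod_filter]
    refine Finset.prod_congr (by ext; simp) fun i _ => ?_
    rw [hv, ← map_sub]
    congr 1
    ext x
    simp [root_apply]
  rw [key, key, ← Matrix.det_permute]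
  rfl

theorem prod_dvd_of_prime {R ι : Type*} [CommRing R] [IsDomain R] {s : Finset ι} {f : ι → R}
    {x : R} (hp : ∀ i ∈ s, Prime (f i)) (hne : ∀ i ∈ s, ∀ j ∈ s, i ≠ j → ¬ f i ∣ f j)
    (hx : ∀ i ∈ s, f i ∣ x) : ∏ i ∈ s, f i ∣ x := by
  classical
  induction s using Finset.induction_on with
  | empty => simp
  | insert i s hi ih =>
    obtain ⟨y, rfl⟩ := ih (fun j hj => hp j (by simp [hj]))
      (fun j hj k hk => hne j (by simp [hj]) k (by simp [hk])) fun j hj => hx j (by simp [hj])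
    rw [Finset.prod_insert hi, mul_comm]
    apply mul_dvd_mul_left
    have hpi := hp i (by simp)
    refine (hpi.dvd_or_dvd (hx i (by simp))).resolve_left fun hd => ?_
    obtain ⟨j, hj, hd⟩ := (hpi.dvd_finsetProd_iff _).1 hd
    exact hne i (by simp) j (by simp [hj]) (fun hij => hi (hij ▸ hj)) hd

/-- Integration by localization, multiplied by the Vandermonde product: up to sign, this product
is at each vertex `w` the product of the labels at `w` and of `rootProd (nonHessPairs h) w`. -/
noncomputable def integral (h : Fin n → Fin n) :
    (Perm (Fin n) → SymmetricAlgebra ℤ (WeightLattice n)) →ₗ[SymmetricAlgebra ℤ (WeightLattice n)]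
      SymmetricAlgebra ℤ (WeightLattice n) :=
  ∑ w : Perm (Fin n), (((Equiv.Perm.sign w : ℤ) : SymmetricAlgebra ℤ (WeightLattice n)) *
    rootProd (nonHessPairs h) w) • LinearMap.proj w

theorem integral_apply (ξ : Perm (Fin n) → SymmetricAlgebra ℤ (WeightLattice n)) :
    integral h ξ = ∑ w : Perm (Fin n), (Equiv.Perm.sign w : ℤ) *
      rootProd (nonHessPairs h) w * ξ w := by
  simp [integral, LinearMap.sum_apply]

/-- The terms at `w` and `(a b) w` cancel modulo `t_a - t_b`: if the two vertices are adjacent, the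
values of the class agree and the signs differ; otherwise both terms are divisible. -/
theorem root_dvd_integral {ξ : Perm (Fin n) → SymmetricAlgebra ℤ (WeightLattice n)}
    (hξ : ξ ∈ (hessGraph h).eqCohomology) {a b : Fin n} (hab : a ≠ b) :
    ι ℤ _ (root a b) ∣ integral h ξ := by
  rw [← Ideal.mem_span_singleton, ← Ideal.Quotient.eq_zero_iff_mem, integral_apply, map_sum]
  refine Finset.sum_involution (fun w _ => swap a b * w) ?_ ?_ (fun _ _ => Finset.mem_univ _)
    (fun w _ => Equiv.swap_mul_self_mul _ _ _)
  · intro w _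
    rw [← map_add, Ideal.Quotient.eq_zero_iff_mem, Ideal.mem_span_singleton,
      Equiv.Perm.sign_mul, Equiv.Perm.sign_swap hab]
    by_cases hadj : (w⁻¹ b < w⁻¹ a ∧ w⁻¹ a ≤ h (w⁻¹ b)) ∨ (w⁻¹ a < w⁻¹ b ∧ w⁻¹ b ≤ h (w⁻¹ a))
    · have h1 := root_dvd_sub_swap_mul hξ hadj
      have h2 : ι ℤ _ (root a b) ∣ rootProd (nonHessPairs h) w -
          rootProd (nonHessPairs h) (swap a b * w) :=
        root_dvd_sub_swap_mul (rootProd_mem_eqCohomology _) hadj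
      obtain ⟨x, hx⟩ := h1
      obtain ⟨y, hy⟩ := h2
      push_cast
      refine ⟨(Equiv.Perm.sign w : ℤ) *
        (y * ξ w + rootProd (nonHessPairs h) (swap a b * w) * x), ?_⟩
      linear_combination (Equiv.Perm.sign w : ℤ) * ξ w * hy +
        (Equiv.Perm.sign w : ℤ) * rootProd (nonHessPairs h) (swap a b * w) * hx
    · have key : ∀ u : Perm (Fin n), (u = w ∨ u = swap a b * w) →
          ι ℤ _ (root a b) ∣ rootProd (nonHessPairs h) u := by
        intro u hu
        have hu' : (u (w⁻¹ a) = a ∧ u (w⁻¹ b) = b) ∨ (u (w⁻¹ a) = b ∧ u (w⁻¹ b) = a) := by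
          rcases hu with rfl | rfl <;> simp
        have hr : ∀ c d : Fin n, (c = a ∧ d = b) ∨ (c = b ∧ d = a) →
            ι ℤ (WeightLattice n) (root a b) ∣ ι ℤ _ (root c d) := by
          rintro c d (⟨rfl, rfl⟩ | ⟨rfl, rfl⟩)
          · exact dvd_rfl
          · rw [root_swap c d, map_neg, neg_dvd]
        rcases lt_or_gt_of_ne (w⁻¹.injective.ne hab) with hlt | hlt
        · refine (hr _ _ ?_).trans (Finset.dvd_prod_of_mem _ (a := (w⁻¹ b, w⁻¹ a)) ?_)
          · tauto
          · simp only [nonHessPairs, descendingPairs, Finset.mem_filter, Finset.mem_univ, true_and]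
            tauto
        · refine (hr _ _ ?_).trans (Finset.dvd_prod_of_mem _ (a := (w⁻¹ a, w⁻¹ b)) ?_)
          · tauto
          · simp only [nonHessPairs, descendingPairs, Finset.mem_filter, Finset.mem_univ, true_and]
            tauto
      exact dvd_add (((key _ (Or.inl rfl)).mul_left _).mul_right _)
        (((key _ (Or.inr rfl)).mul_left _).mul_right _)
  · intro w _ _ hw
    exact hab (Equiv.swap_eq_one_iff.1 (mul_eq_right.1 hw))

/-- Integrality of localization: the integral of a class is a polynomial. -/
theorem rootProd_dvd_integral {ξ : Perm (Fin n) → SymmetricAlgebra ℤ (WeightLattice n)}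
    (hξ : ξ ∈ (hessGraph h).eqCohomology) :
    rootProd (descendingPairs n) 1 ∣ integral h ξ := by
  refine prod_dvd_of_prime ?_ ?_ ?_
  · rintro ⟨i, j⟩ hp
    simp only [descendingPairs, Finset.mem_filter] at hp
    exact prime_root hp.2.ne'
  · rintro ⟨i, j⟩ hp ⟨k, l⟩ hq hne
    simp only [descendingPairs, Finset.mem_filter] at hp hq
    refine not_root_dvd_root hq.2.ne' ?_ ?_
    · rintro ⟨h1, h2⟩
      exact hne (Prod.ext h1 h2)
    · rintro ⟨h1, h2⟩
      change i = l at h1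
      change j = k at h2
      subst h1 h2
      exact lt_asymm hp.2 hq.2
  · rintro ⟨i, j⟩ hp
    simp only [descendingPairs, Finset.mem_filter] at hp
    exact root_dvd_integral hξ hp.2.ne'

theorem integral_of_mem_posIdeal {ξ : (hessGraph h).eqCohomology}
    (hξ : ξ ∈ (hessGraph h).posIdeal) : ∃ g : SymmetricAlgebra ℤ (WeightLattice n),
      algebraMapInv g = 0 ∧ integral h ξ.1 = rootProd (descendingPairs n) 1 * g := by
  suffices H : ∀ η : (hessGraph h).eqCohomology, ∃ g : SymmetricAlgebra ℤ (WeightLattice n),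
      algebraMapInv g = 0 ∧ integral h (ξ * η).1 = rootProd (descendingPairs n) 1 * g by
    simpa using H 1
  refine Submodule.span_induction ?_ ?_ ?_ ?_ hξ
  · rintro _ ⟨x, hx, rfl⟩ η
    obtain ⟨m, hm⟩ := rootProd_dvd_integral η.2
    refine ⟨x * m, by rw [map_mul, hx, zero_mul], ?_⟩
    have : ((hessGraph h).const x * η).1 = x • η.1 := rfl
    rw [this, map_smul, hm, smul_eq_mul]
    ring
  · intro η
    refine ⟨0, map_zero _, ?_⟩
    rw [zero_mul, mul_zero]
    exact map_zero _
  · intro x y _ _ hx hy η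
    obtain ⟨g, hg, hg'⟩ := hx η
    obtain ⟨k, hk, hk'⟩ := hy η
    refine ⟨g + k, by rw [map_add, hg, hk, add_zero], ?_⟩
    rw [mul_add, ← hg', ← hk', add_mul]
    exact map_add _ _ _
  · intro a x _ hx η
    obtain ⟨g, hg⟩ := hx (a * η)
    refine ⟨g, ?_⟩
    rwa [smul_eq_mul, mul_comm a, mul_assoc]

end Integration

/-! ### Classes of subgraphs and faithfulness -/

section Faithful

variable {n : ℕ} {h : Fin n → Fin n}

/-- A class restricted to a set `A` of vertices stays a class if it is divisible by the labels of
the edges that leave `A`. -/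
theorem indicator_mem_eqCohomology {A : Set (Perm (Fin n))}
    {ξ : Perm (Fin n) → SymmetricAlgebra ℤ (WeightLattice n)}
    (hξ : ξ ∈ (hessGraph h).eqCohomology)
    (hA : ∀ w i j, j < i → i ≤ h j → ¬ (w ∈ A ↔ w * swap i j ∈ A) →
      ι ℤ _ (root (w i) (w j)) ∣ ξ w) :
    A.indicator ξ ∈ (hessGraph h).eqCohomology := by
  classical
  rintro ⟨w, ⟨⟨i, j⟩, hji, hij⟩⟩
  have h1 : ι ℤ _ (root (w i) (w j)) ∣ ξ w - ξ (w * swap i j) := hξ (w, ⟨(i, j), hji, hij⟩)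
  have h2 := hA w i j hji hij
  change ι ℤ _ (root (w i) (w j)) ∣ A.indicator ξ w - A.indicator ξ (w * swap i j)
  by_cases hw : w ∈ A <;> by_cases hu : w * swap i j ∈ A
  · rwa [Set.indicator_of_mem hw, Set.indicator_of_mem hu]
  · rw [Set.indicator_of_mem hw, Set.indicator_of_notMem hu, sub_zero]
    exact h2 (by tauto)
  · rw [Set.indicator_of_notMem hw, Set.indicator_of_mem hu]
    convert dvd_sub h1 (h2 (by tauto)) using 1
    ring
  · rw [Set.indicator_of_notMem hw, Set.indicator_of_notMem hu, sub_zero]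
    exact dvd_zero _

/-- The class of the subgraph `{w | w a = k}`, for the least index `a`: at a vertex of the subgraph,
it is the product of the labels of the edges leaving the subgraph. -/
noncomputable def firstClass (h : Fin n → Fin n) {a : Fin n} (ha : ∀ j, a ≤ j) (k : Fin n) :
    (hessGraph h).eqCohomology :=
  ⟨Set.indicator {w | w a = k} (rootProd ((hessPairs h).filter fun p => p.2 = a)), by
    refine indicator_mem_eqCohomology (rootProd_mem_eqCohomology _) fun w i j hji hij hA => ?_
    have hj : j = a := by
      by_contra hj
      apply hA
      have hi : a ≠ i := ((ha j).trans_lt hji).ne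
      simp [Equiv.swap_apply_of_ne_of_ne hi (Ne.symm hj)]
    subst hj
    refine Finset.dvd_prod_of_mem (fun p : Fin n × Fin n => ι ℤ _ (root (w p.1) (w p.2)))
      (a := (i, j)) ?_
    simp [hessPairs, descendingPairs, hji, hij]⟩

/-- A multiple of the class of the subgraph `{w | w z = l}`, for the greatest index `z`: the factors
are all the labels that do not occur in `firstClass`. They include the labels of the edges leaving
the subgraph, because the graph has no edge for the transposition `(a z)`. -/
noncomputable def lastClass (h : Fin n → Fin n) {a z : Fin n} (hz : ∀ j, j ≤ z) (haz : h a < z)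
    (l : Fin n) : (hessGraph h).eqCohomology :=
  ⟨Set.indicator {w | w z = l} (rootProd ((hessPairs h).filter fun p => ¬ p.2 = a)), by
    refine indicator_mem_eqCohomology (rootProd_mem_eqCohomology _) fun w i j hji hij hA => ?_
    have hi : i = z := by
      by_contra hi
      apply hA
      have hj : z ≠ j := (hji.trans_le (hz i)).ne'
      simp [Equiv.swap_apply_of_ne_of_ne (Ne.symm hi) hj]
    have hj : j ≠ a := by
      rintro rfl
      exact absurd hij (not_le.2 (hi ▸ haz))
    refine Finset.dvd_prod_of_mem (fun p : Fin n × Fin n => ι ℤ _ (root (w p.1) (w p.2)))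
      (a := (i, j)) ?_
    simp [hessPairs, descendingPairs, hji, hij, hj]⟩

theorem firstClass_apply {a : Fin n} (ha : ∀ j, a ≤ j) (k : Fin n) (w : Perm (Fin n)) :
    (firstClass h ha k).1 w =
      if w a = k then rootProd ((hessPairs h).filter fun p => p.2 = a) w else 0 := by
  classical
  simp only [firstClass, Set.indicator_apply, Set.mem_ofPred_eq]

theorem lastClass_apply {a z : Fin n} (hz : ∀ j, j ≤ z) (haz : h a < z) (l : Fin n)
    (w : Perm (Fin n)) : (lastClass h hz haz l).1 w =
      if w z = l then rootProd ((hessPairs h).filter fun p => ¬ p.2 = a) w else 0 := by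
  classical
  simp only [lastClass, Set.indicator_apply, Set.mem_ofPred_eq]

theorem eqPullback_firstClass {a : Fin n} (ha : ∀ j, a ≤ j) (k : Fin n) (σ : Perm (Fin n)) :
    GKMGraph.eqPullback (hessAut h σ) (firstClass h ha k) = firstClass h ha (σ⁻¹ k) := by
  ext w : 2
  rw [eqPullback_hessAut_apply]
  rw [firstClass_apply, firstClass_apply]
  have hiff : w a = σ⁻¹ k ↔ (σ * w) a = k := Equiv.Perm.eq_inv_iff_eq
  by_cases hk : (σ * w) a = k
  · rw [if_pos hk, if_pos (hiff.2 hk)]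
    simp [rootProd, symMap_ι, weightPerm_root]
  · rw [if_neg hk, if_neg (hiff.not.2 hk), map_zero]

theorem firstClass_mul_lastClass_self {a z : Fin n} (ha : ∀ j, a ≤ j) (hz : ∀ j, j ≤ z)
    (haz : h a < z) (hne : a ≠ z) (k : Fin n) : firstClass h ha k * lastClass h hz haz k = 0 := by
  ext w : 2
  change (firstClass h ha k).1 w * (lastClass h hz haz k).1 w = 0
  rw [firstClass_apply, lastClass_apply]
  split_ifs with h1 h2
  · exact absurd (w.injective (h1.trans h2.symm)) hne
  all_goals simp

/-- The product of the two classes takes the value `∏ (labels at w)` at the vertices `w` with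
`w a = k` and `w z = l`, so each of these contributes `1` to the localization formula. -/
theorem integral_firstClass_mul_lastClass {a z : Fin n} (ha : ∀ j, a ≤ j) (hz : ∀ j, j ≤ z)
    (haz : h a < z) (k l : Fin n) :
    integral h (firstClass h ha k * lastClass h hz haz l).1 =
      rootProd (descendingPairs n) 1 *
        ((Finset.univ.filter fun w : Perm (Fin n) => w a = k ∧ w z = l).card : ℤ) := by
  rw [integral_apply, Finset.card_filter]
  push_cast
  rw [Finset.mul_sum]
  refine Finset.sum_congr rfl fun w _ => ?_
  change _ * ((firstClass h ha k).1 w * (lastClass h hz haz l).1 w) = _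
  rw [firstClass_apply, lastClass_apply]
  by_cases h1 : w a = k
  swap
  · simp [h1]
  by_cases h2 : w z = l
  swap
  · simp [h2]
  simp only [h1, h2, and_self, if_true, mul_one]
  have h3 : rootProd ((hessPairs h).filter fun p => p.2 = a) w *
      rootProd ((hessPairs h).filter fun p => ¬ p.2 = a) w = rootProd (hessPairs h) w :=
    Finset.prod_filter_mul_prod_filter_not _ _ _
  have h4 : ((Equiv.Perm.sign w : ℤ) : SymmetricAlgebra ℤ (WeightLattice n)) *
      (Equiv.Perm.sign w : ℤ) = 1 := by
    rw [← Int.cast_mul, ← Units.val_mul, Int.units_mul_self]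
    simp
  rw [h3, mul_assoc, mul_comm (rootProd (nonHessPairs h) w), rootProd_hessPairs_mul,
    rootProd_descendingPairs, ← mul_assoc, h4, one_mul]

theorem eq_one_of_hessAut_mem_autStar {a z : Fin n} (ha : ∀ j, a ≤ j) (hz : ∀ j, j ≤ z)
    (haz : h a < z) (hne : a ≠ z) {σ : Perm (Fin n)}
    (hσ : hessAut h σ ∈ (hessGraph h).AutStar) : σ = 1 := by
  by_contra hσ1
  obtain ⟨k, hk⟩ : ∃ k, σ⁻¹ k ≠ k := by
    by_contra! hk
    exact hσ1 (inv_eq_one.1 (Equiv.ext hk))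
  set l := σ⁻¹ k
  obtain ⟨N, hN, hmem⟩ := GKMGraph.exists_zsmul_sub_mem_posIdeal hσ (firstClass h ha k)
  rw [eqPullback_firstClass] at hmem
  have h1 := (hessGraph h).posIdeal.mul_mem_right (lastClass h hz haz k) hmem
  rw [smul_mul_assoc, sub_mul, firstClass_mul_lastClass_self ha hz haz hne, sub_zero] at h1
  obtain ⟨g, hg, hg'⟩ := integral_of_mem_posIdeal h1
  have h2 : integral h (N • (firstClass h ha l * lastClass h hz haz k)).1 =
      N • integral h (firstClass h ha l * lastClass h hz haz k).1 :=
    map_zsmul (integral h) N _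
  rw [h2, integral_firstClass_mul_lastClass, zsmul_eq_mul, mul_left_comm] at hg'
  have hΔ : rootProd (descendingPairs n) 1 ≠ 0 := by
    refine Finset.prod_ne_zero_iff.2 fun p hp => ?_
    simp only [descendingPairs, Finset.mem_filter] at hp
    exact (prime_root hp.2.ne').ne_zero
  have h3 := mul_left_cancel₀ hΔ hg'
  rw [← h3, ← Int.cast_mul, map_intCast, Int.cast_id, mul_eq_zero] at hg
  have h4 := Int.natCast_eq_zero.1 (hg.resolve_left hN)
  rw [Finset.card_eq_zero] at h4
  -- a permutation with `a ↦ l` and `z ↦ k`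
  have h5 : swap (swap a l z) k * swap a l ∈
      Finset.univ.filter fun w : Perm (Fin n) => w a = l ∧ w z = k := by
    have h6 : l ≠ swap a l z := fun h7 => hne <| by
      apply (swap a l).injective
      rwa [Equiv.swap_apply_left]
    simp [Equiv.swap_apply_of_ne_of_ne h6 hk]
  rw [h4] at h5
  exact absurd h5 (Finset.notMem_empty _)

end Faithful

/-! ### Flags and connectedness of Hessenberg varieties -/

section Flags

variable {n : ℕ} {h : Fin n → Fin n} {S : Matrix (Fin n) (Fin n) ℂ}

/-- A basis of eigenvectors with distinct eigenvalues. -/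
structure IsSimpleEigenbasis (S : Matrix (Fin n) (Fin n) ℂ)
    (B : Module.Basis (Fin n) ℂ (Fin n → ℂ)) (c : Fin n → ℂ) : Prop where
  injective : Function.Injective c
  mulVec_apply : ∀ i, S.mulVecLin (B i) = c i • B i

theorem IsRegularSemisimple.exists_isSimpleEigenbasis (hS : IsRegularSemisimple S) :
    ∃ B c, IsSimpleEigenbasis S B c := by
  classical
  have hcard : S.charpoly.roots.toFinset.card = n := by
    rw [Multiset.toFinset_card_of_nodup hS,
      ← (IsAlgClosed.splits S.charpoly).natDegree_eq_card_roots, S.charpoly_natDegree_eq_dim,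
      Fintype.card_fin]
  set e := S.charpoly.roots.toFinset.equivFinOfCardEq hcard
  set c : Fin n → ℂ := fun i => e.symm i with hc
  have hinj : Function.Injective c := Subtype.val_injective.comp e.symm.injective
  have hev : ∀ i, ∃ v, Module.End.HasEigenvector S.mulVecLin (c i) v := by
    intro i
    apply Module.End.HasEigenvalue.exists_hasEigenvector
    rw [Module.End.hasEigenvalue_iff_isRoot_charpoly]
    have h1 : S.mulVecLin.charpoly = S.charpoly := Matrix.charpoly_mulVecLin S
    rw [h1]
    have h2 := (e.symm i).2
    rw [Multiset.mem_toFinset] at h2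
    exact Polynomial.isRoot_of_mem_roots h2
  choose v hv using hev
  have hli := Module.End.eigenvectors_linearIndependent' S.mulVecLin c hinj v hv
  refine ⟨basisOfLinearIndependentOfCardEqFinrank' v hli (by simp), c, hinj, fun i => ?_⟩
  rw [coe_basisOfLinearIndependentOfCardEqFinrank']
  exact (hv i).apply_eq_smul

theorem IsSimpleEigenbasis.reindex {B : Module.Basis (Fin n) ℂ (Fin n → ℂ)} {c : Fin n → ℂ}
    (hB : IsSimpleEigenbasis S B c) (e : Perm (Fin n)) :
    IsSimpleEigenbasis S (B.reindex e) (c ∘ e.symm) :=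
  ⟨hB.injective.comp e.symm.injective, fun i => by
    rw [Module.Basis.reindex_apply]; exact hB.mulVec_apply _⟩

theorem IsSimpleEigenbasis.coord_mulVec {B : Module.Basis (Fin n) ℂ (Fin n → ℂ)} {c : Fin n → ℂ}
    (hB : IsSimpleEigenbasis S B c) (i : Fin n) (v : Fin n → ℂ) :
    B.coord i (S.mulVecLin v) = c i * B.coord i v := by
  have : B.coord i ∘ₗ S.mulVecLin = c i • B.coord i := by
    refine B.ext fun j => ?_
    rw [LinearMap.comp_apply, hB.mulVec_apply, map_smul, LinearMap.smul_apply]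
    by_cases hij : j = i
    · rw [hij]
    · simp [Finsupp.single_eq_of_ne (Ne.symm hij)]
  exact LinearMap.congr_fun this v

/-- An invariant subspace is spanned by eigenvectors: if some vector in it has a nonzero `k`-th
coordinate, then the other coordinates can be removed by applying the operators `S - cᵢ`. -/
theorem IsSimpleEigenbasis.mem_or_le_ker {B : Module.Basis (Fin n) ℂ (Fin n → ℂ)} {c : Fin n → ℂ}
    (hB : IsSimpleEigenbasis S B c) {V : Submodule ℂ (Fin n → ℂ)} (hV : V.map S.mulVecLin ≤ V)
    (k : Fin n) : B k ∈ V ∨ V ≤ LinearMap.ker (B.coord k) := by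
  classical
  by_contra! hcon
  obtain ⟨hk, hle⟩ := hcon
  obtain ⟨v, hv, hvk⟩ := SetLike.not_le_iff_exists.1 hle
  have key : ∀ s : Finset (Fin n), k ∉ s →
      ∃ u ∈ V, B.coord k u ≠ 0 ∧ ∀ i ∈ s, B.coord i u = 0 := by
    intro s
    induction s using Finset.induction_on with
    | empty => exact fun _ => ⟨v, hv, hvk, by simp⟩
    | insert i s _ ih =>
      intro hks
      rw [Finset.mem_insert, not_or] at hks
      obtain ⟨u, hu, huk, hus⟩ := ih hks.2
      have hm : ∀ m, B.coord m (S.mulVecLin u - c i • u) = (c m - c i) * B.coord m u := by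
        intro m
        rw [map_sub, hB.coord_mulVec, map_smul, smul_eq_mul, sub_mul]
      refine ⟨S.mulVecLin u - c i • u,
        V.sub_mem (hV (Submodule.mem_map_of_mem hu)) (V.smul_mem _ hu), ?_, ?_⟩
      · rw [hm]
        exact mul_ne_zero (sub_ne_zero.2 (hB.injective.ne hks.1)) huk
      · intro m hms
        rw [hm]
        rcases Finset.mem_insert.1 hms with rfl | hms
        · rw [sub_self, zero_mul]
        · rw [hus m hms, mul_zero]
  obtain ⟨u, hu, huk, hus⟩ := key (Finset.univ.erase k) (by simp)
  have hu' : u = B.coord k u • B k := by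
    conv_lhs => rw [← B.sum_repr u]
    refine Finset.sum_eq_single k (fun i _ hi => ?_) (by simp)
    have : B.repr u i = 0 := hus i (by simp [hi])
    rw [this, zero_smul]
  rw [hu'] at hu
  exact hk ((V.smul_mem_iff huk).1 hu)

/-- The flag of spans of initial segments of a basis. -/
noncomputable def basisFlag (B : Module.Basis (Fin n) ℂ (Fin n → ℂ)) : CompleteFlag n where
  space i := Submodule.span ℂ (Set.range fun k : Set.Iic i => B k)
  mono := by
    intro i j hij
    apply Submodule.span_mono
    rintro _ ⟨⟨k, hk⟩, rfl⟩
    exact ⟨⟨k, le_trans hk hij⟩, rfl⟩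
  finrank_space i := by
    have h2 := finrank_span_eq_card
      (B.linearIndependent.comp (fun k : Set.Iic i => (k : Fin n)) Subtype.val_injective)
    rw [show Fintype.card (Set.Iic i) = i + 1 by simp] at h2
    exact h2

theorem mem_basisFlag (B : Module.Basis (Fin n) ℂ (Fin n → ℂ)) {i j : Fin n} (hij : i ≤ j) :
    B i ∈ (basisFlag B).space j :=
  Submodule.subset_span ⟨⟨i, hij⟩, rfl⟩

theorem basisFlag_le_iff (B : Module.Basis (Fin n) ℂ (Fin n → ℂ)) {j : Fin n}
    {W : Submodule ℂ (Fin n → ℂ)} : (basisFlag B).space j ≤ W ↔ ∀ i ≤ j, B i ∈ W := by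
  refine Submodule.span_le.trans ⟨fun H i hi => H ⟨⟨i, hi⟩, rfl⟩, ?_⟩
  rintro H _ ⟨⟨i, hi⟩, rfl⟩
  exact H i hi

theorem IsSimpleEigenbasis.basisFlag_mem_hess {B : Module.Basis (Fin n) ℂ (Fin n → ℂ)}
    {c : Fin n → ℂ} (hB : IsSimpleEigenbasis S B c) (hh : IsHessenbergFunction h) :
    basisFlag B ∈ Hess S h := by
  intro j
  rw [Submodule.map_le_iff_le_comap, basisFlag_le_iff]
  intro i hi
  rw [Submodule.mem_comap, hB.mulVec_apply]
  exact Submodule.smul_mem _ _ (mem_basisFlag B (hi.trans (hh.le_apply j)))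

theorem isClosed_setOf_space_le_ker (f : (Fin n → ℂ) →ₗ[ℂ] ℂ) (j : Fin n) :
    IsClosed {F : CompleteFlag n | F.space j ≤ LinearMap.ker f} := by
  refine isClosed_coinduced.2 ?_
  have : columnFlag ⁻¹' {F : CompleteFlag n | F.space j ≤ LinearMap.ker f} =
      ⋂ k : Set.Iic j, {g : Matrix.GeneralLinearGroup (Fin n) ℂ | f (fun a => g.1 a k) = 0} := by
    ext g
    simp only [Set.mem_preimage, Set.mem_ofPred_eq, Set.mem_iInter]
    refine Submodule.span_le.trans ⟨fun H i => H ⟨i, rfl⟩, ?_⟩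
    rintro H _ ⟨i, rfl⟩
    exact H i
  rw [this]
  refine isClosed_iInter fun k => isClosed_singleton.preimage (f := fun g :
    Matrix.GeneralLinearGroup (Fin n) ℂ => f fun a => g.1 a k) ?_
  refine f.continuous_of_finiteDimensional.comp (continuous_pi fun a => ?_)
  have hcont : Continuous fun g : Matrix.GeneralLinearGroup (Fin n) ℂ => g.1 :=
    Units.continuous_val
  exact hcont.matrix_elem a k

theorem mem_columnFlag_iff (g : Matrix.GeneralLinearGroup (Fin n) ℂ) (v : Fin n → ℂ) (j : Fin n) :
    v ∈ (columnFlag g).space j ↔ ∀ a, j < a → (g⁻¹.1.mulVec v) a = 0 := by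
  have hcol : ∀ k, g⁻¹.1.mulVec (fun a => g.1 a k) = Pi.single k 1 := by
    intro k
    have h1 : (fun a => g.1 a k) = g.1.mulVec (Pi.single k 1) := by
      rw [Matrix.mulVec_single_one]; rfl
    rw [h1, Matrix.mulVec_mulVec, Units.inv_mul, Matrix.one_mulVec]
  constructor
  · intro hv a hja
    set W : Submodule ℂ (Fin n → ℂ) := LinearMap.ker (LinearMap.proj a ∘ₗ g⁻¹.1.mulVecLin)
    suffices H : (columnFlag g).space j ≤ W from H hv
    refine Submodule.span_le.2 ?_
    rintro _ ⟨⟨k, hk⟩, rfl⟩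
    change g⁻¹.1.mulVec (fun a => g.1 a k) a = 0
    rw [hcol, Pi.single_apply, if_neg (hk.trans_lt hja).ne']
  · intro hv
    have h1 : v = ∑ k, g⁻¹.1.mulVec v k • fun a => g.1 a k := by
      have h2 : g.1.mulVec (g⁻¹.1.mulVec v) = v := by
        rw [Matrix.mulVec_mulVec, Units.mul_inv, Matrix.one_mulVec]
      conv_lhs => rw [← h2]
      ext a
      simp only [Matrix.mulVec, dotProduct, Finset.sum_apply, Pi.smul_apply, smul_eq_mul]
      exact Finset.sum_congr rfl fun k _ => mul_comm _ _
    rw [h1]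
    refine Submodule.sum_mem _ fun k _ => ?_
    rcases lt_or_ge j k with hk | hk
    · rw [hv k hk, zero_smul]
      exact Submodule.zero_mem _
    · exact Submodule.smul_mem _ _ (Submodule.subset_span ⟨⟨k, hk⟩, rfl⟩)

theorem isClosed_setOf_mem_space (v : Fin n → ℂ) (j : Fin n) :
    IsClosed {F : CompleteFlag n | v ∈ F.space j} := by
  refine isClosed_coinduced.2 ?_
  have : columnFlag ⁻¹' {F : CompleteFlag n | v ∈ F.space j} =
      ⋂ a : Set.Ioi j, {g : Matrix.GeneralLinearGroup (Fin n) ℂ | (g⁻¹.1.mulVec v) a = 0} := by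
    ext g
    simp only [Set.mem_preimage, Set.mem_ofPred_eq, Set.mem_iInter]
    exact (mem_columnFlag_iff g v j).trans ⟨fun H a => H a a.2, fun H a ha => H ⟨a, ha⟩⟩
  rw [this]
  refine isClosed_iInter fun a => isClosed_singleton.preimage (f := fun g :
    Matrix.GeneralLinearGroup (Fin n) ℂ => (g⁻¹.1.mulVec v) a) ?_
  have hcont : Continuous fun g : Matrix.GeneralLinearGroup (Fin n) ℂ => g⁻¹.1.mulVec v :=
    (Units.continuous_val.comp continuous_inv).matrix_mulVec continuous_const
  exact (continuous_apply (a : Fin n)).comp hcont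

/-- If `h j = j`, then `V_j` is invariant, and the flags with a given eigenvector in `V_j` form a
closed and open subset of the Hessenberg variety. -/
theorem lt_apply_of_isConnected_hess (hh : IsHessenbergFunction h) (hS : IsRegularSemisimple S)
    (hconn : IsConnected (Hess S h)) (j : Fin n) (hj : (j : ℕ) + 1 < n) : j < h j := by
  refine lt_of_le_of_ne (hh.le_apply j) fun hjj => ?_
  obtain ⟨B, c, hB⟩ := hS.exists_isSimpleEigenbasis
  have hcover : Hess S h ⊆
      {F | B j ∈ F.space j} ∪ {F | F.space j ≤ LinearMap.ker (B.coord j)} := by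
    intro F hF
    have hinv := hF j
    rw [← hjj] at hinv
    exact hB.mem_or_le_ker hinv j
  have hmem : (Hess S h ∩ {F | B j ∈ F.space j}).Nonempty :=
    ⟨basisFlag B, hB.basisFlag_mem_hess hh, mem_basisFlag B le_rfl⟩
  have hker : (Hess S h ∩ {F | F.space j ≤ LinearMap.ker (B.coord j)}).Nonempty := by
    -- exchanging `B j` with a later basis vector removes it from the `j`-th space
    set z : Fin n := ⟨j + 1, hj⟩
    have hjz : j < z := Fin.lt_def.2 (Nat.lt_succ_self _)
    refine ⟨basisFlag (B.reindex (swap j z)), (hB.reindex _).basisFlag_mem_hess hh, ?_⟩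
    change (basisFlag _).space j ≤ _
    rw [basisFlag_le_iff]
    intro i hi
    have h1 : swap j z i ≠ j := by
      intro h2
      rw [Equiv.swap_apply_eq_iff, Equiv.swap_apply_left] at h2
      exact absurd hi (not_le.2 (h2 ▸ hjz))
    rw [LinearMap.mem_ker, Module.Basis.reindex_apply, Equiv.symm_swap]
    simp [Finsupp.single_eq_of_ne (Ne.symm h1)]
  obtain ⟨F, -, hF1, hF2⟩ := isPreconnected_closed_iff.1 hconn.isPreconnected _ _
    (isClosed_setOf_mem_space (B j) j) (isClosed_setOf_space_le_ker (B.coord j) j) hcover hmem hker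
  have h1 : B.coord j (B j) = 0 := hF2 hF1
  simp at h1

theorem hess_eq_univ (hfull : ∀ i j, i ≤ h j) : Hess S h = Set.univ := by
  refine Set.eq_univ_of_forall fun F j => ?_
  have : F.space (h j) = ⊤ := by
    apply Submodule.eq_top_of_finrank_eq
    have h1 := hfull ⟨n - 1, by have := j.2; omega⟩ j
    rw [Fin.le_def] at h1
    have h2 := (h j).2
    simp only [F.finrank_space, Module.finrank_fin_fun]
    simp only at h1
    omega
  rw [this]
  exact le_top

/-- If `h a < z`, then a flag whose first member is spanned by `B a + B z` need not satisfy the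
Hessenberg condition. -/
theorem hess_ne_univ (hS : IsRegularSemisimple S) {a z : Fin n} (ha : ∀ j, a ≤ j)
    (haz : h a < z) : Hess S h ≠ Set.univ := by
  intro huniv
  obtain ⟨B, c, hB⟩ := hS.exists_isSimpleEigenbasis
  have hne : a ≠ z := ((ha _).trans_lt haz).ne
  have hcoord : ∀ i j, B.coord i (B j) = if j = i then 1 else 0 := fun i j => by
    simp [Finsupp.single_apply]
  have h0 : B.coord a (B z) = 0 := by rw [hcoord, if_neg hne.symm]
  set B' := B.map (LinearEquiv.transvection h0)
  have hB' : ∀ i, B' i = B i + B.coord a (B i) • B z := fun i => rfl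
  have hF : basisFlag B' ∈ Hess S h := huniv ▸ Set.mem_univ _
  have h1 := hF a (Submodule.mem_map_of_mem (mem_basisFlag B' le_rfl))
  have h2 : (basisFlag B').space (h a) ≤ LinearMap.ker (B.coord a - B.coord z) := by
    rw [basisFlag_le_iff]
    intro i hi
    have hiz : i ≠ z := (hi.trans_lt haz).ne
    simp only [hB', LinearMap.mem_ker, LinearMap.sub_apply, map_add, map_smul, hcoord, hiz,
      if_false, hne.symm, smul_eq_mul, if_true]
    ring
  have h3 := h2 h1
  simp only [hB', LinearMap.mem_ker, LinearMap.sub_apply, hB.coord_mulVec, map_add, map_smul,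
    hcoord, hne, hne.symm, if_false, if_true, smul_eq_mul] at h3
  exact hne (hB.injective (by linear_combination h3))

end Flags

/-! ### Automorphisms of the GKM graph -/

theorem mainTheorem7 (n : ℕ) (h : Fin n → Fin n) (hh : IsHessenbergFunction h)
    (S : Matrix (Fin n) (Fin n) ℂ) (hS : IsRegularSemisimple S) (hconn : IsConnected (Hess S h)) :
    (Hess S h = Set.univ →
      ((hessGraph h).AutStar : Set (hessGraph h).Aut) = Set.range (hessAut h)) ∧
    (Hess S h ≠ Set.univ → (hessGraph h).AutStar = ⊥) := by
  have hc := lt_apply_of_isConnected_hess hh hS hconn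
  by_cases hfull : ∀ i j, i ≤ h j
  · refine ⟨fun _ => Set.Subset.antisymm ?_ ?_, fun hne => absurd (hess_eq_univ hfull) hne⟩
    · intro F hF
      exact ⟨F.1.1 1, (eq_hessAut_of_mem_autStar hc hF).symm⟩
    · rintro _ ⟨σ, rfl⟩
      exact hessAut_mem_autStar hfull σ
  · push Not at hfull
    obtain ⟨i, j, hij⟩ := hfull
    have hn : 0 < n := i.pos
    set a : Fin n := ⟨0, hn⟩
    set z : Fin n := ⟨n - 1, Nat.sub_lt hn one_pos⟩
    have ha : ∀ j, a ≤ j := fun j => Fin.le_def.2 (Nat.zero_le _)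
    have hz : ∀ j, j ≤ z := fun j => Fin.le_def.2 (Nat.le_sub_one_of_lt j.2)
    have haz : h a < z := ((hh.mono (ha j)).trans_lt hij).trans_le (hz i)
    refine ⟨fun huniv => absurd huniv (hess_ne_univ hS ha haz), fun _ => ?_⟩
    rw [eq_bot_iff]
    intro F hF
    have hF' := eq_hessAut_of_mem_autStar hc hF
    rw [hF'] at hF
    have hσ := eq_one_of_hessAut_mem_autStar ha hz haz ((ha _).trans_lt haz).ne hF
    rw [hσ, hessAut_one] at hF'
    exact Subgroup.mem_bot.2 hF'
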